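/- For $i=1,\dots,N$ let $E^{(i)}$ be a nonempty locally compact separable metric space, $m^{(i)}$ a positive Radon measure on $E^{(i)}$ with full support, $(\mathcal E^{(i)},\mathcal F^{(i)})$ a regular symmetric Dirichlet form on $L^2(E^{(i)},m^{(i)})$, and $\mathbf X^{(i)}$ an associated $m^{(i)}$-symmetric (Hunt) Markov process with transition function $p^{(i)}_t(x,dy)$; that is, $u\in\mathcal F^{(i)}$ iff $\frac1t(u-p^{(i)}_tu,u)_{m^{(i)}}$ has a finite limit as $t\downarrow0$, and $\mathcal E^{(i)}(u,v)=\lim_{t\downarrow 0}\frac1t(u-p^{(i)}_tu,v)_{m^{(i)}}$ for $u,v\in\mathcal F^{(i)}$. Let $E=\prod_iE^{(i)}$, $m=\bigotimes_im^{(i)}$, let $\mathbf X$ be the direct product process, i.e. the process on $E$ with transition function $p_t(x,dy)=\bigotimes_{i}p^{(i)}_t(x^{(i)},dy^{(i)})$, and let $(\mathcal E,\mathcal F)$ be the Dirichlet form on $L^2(E,m)$ associated with $\mathbf X$. Let $\{u^{(i)}_n\}_{n\ge1}\subset\mathcal F^{(i)}$ be sequences, and for $k\ge1$ put $$n^{(i)}(k)=\inf\Big\{n\ge1:\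 \mathcal E^{(i)}(u^{(i)}_n,u^{(i)}_n)\le\frac1k\,(u^{(i)}_n,u^{(i)}_n)_{m^{(i)}}\Big\}\in\mathbb N\cup\{\infty\},\qquad u^{(i)}_\infty:=1,$$ where, if $n^{(i)}(k)=\infty$ for some $k$, it is assumed that $1\in\mathcal F^{(i)}$ and $\mathcal E^{(i)}(1,1)=0$. Suppose that for every $i$ one has $0\le u^{(i)}_{n^{(i)}(k)}\le1$ $m^{(i)}$-a.e. for every $k\ge 1$ and $u^{(i)}_{n^{(i)}(k)}\to1$ $m^{(i)}$-a.e. as $k\to\infty$, and that $$\lim_{k\to\infty}\frac1k\prod_{i=1}^N\big(u^{(i)}_{n^{(i)}(k)},u^{(i)}_{n^{(i)}(k)}\big)_{m^{(i)}}=0 .$$ Then the Dirichlet form $(\mathcal E,\mathcal F)$, equivalently the direct product process $\mathbf X$, is non-transient. Here a symmetric process with transition function $p_t$ (and its Dirichlet form) is called transient if $\int_0^\infty p_tf\,dt<\infty$ $m$-a.e. for every nonnegative $f\in L^1(E,m)$, and non-transient otherwise. -/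

import Mathlib

open MeasureTheory ProbabilityTheory Filter Topology
open scoped NNReal ENNReal

/-- A symmetric Dirichlet form on `L²(X, μ)`: a densely defined, nonnegative definite, symmetric,
closed bilinear form on which the unit contraction operates. -/
structure DirichletForm {X : Type*} [MeasurableSpace X] (μ : Measure X) where
  /-- the domain `𝓕` -/
  domain : Submodule ℝ (Lp ℝ 2 μ)
  /-- the form `𝓔` -/
  form : domain →ₗ[ℝ] domain →ₗ[ℝ] ℝ
  dense_domain : Dense (domain : Set (Lp ℝ 2 μ))
  symm : ∀ u v : domain, form u v = form v u
  nonneg : ∀ u : domain, 0 ≤ form u u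
  /-- `𝓕` is complete for `𝓔₁(u, u) = 𝓔(u, u) + ‖u‖²`. -/
  closed : ∀ u : ℕ → domain,
    (∀ ε > 0, ∃ n₀, ∀ j ≥ n₀, ∀ l ≥ n₀,
      form (u j - u l) (u j - u l) + ‖(u j : Lp ℝ 2 μ) - (u l : Lp ℝ 2 μ)‖ ^ 2 < ε) →
    ∃ v : domain, Tendsto
      (fun n => form (u n - v) (u n - v) + ‖(u n : Lp ℝ 2 μ) - (v : Lp ℝ 2 μ)‖ ^ 2) atTop (𝓝 0)
  /-- If `u ∈ 𝓕`, then `v = (0 ∨ u) ∧ 1` is in `𝓕` and `𝓔(v, v) ≤ 𝓔(u, u)`. -/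
  markov : ∀ u : domain, ∃ v : domain,
    ((v : Lp ℝ 2 μ) : X → ℝ) =ᵐ[μ] (fun x => min (max ((u : Lp ℝ 2 μ) x) 0) 1) ∧
    form v v ≤ form u u

/-- The Dirichlet form is regular: `𝓕 ∩ C_c(X)` is dense in `𝓕` for the `𝓔₁`-norm and dense in
`C_c(X)` for the uniform norm, i.e. `𝓕 ∩ C_c(X)` is a core. -/
def DirichletForm.IsRegular {X : Type*} [TopologicalSpace X] [MeasurableSpace X] {μ : Measure X}
    (𝓔 : DirichletForm μ) : Prop :=
  (∀ u : 𝓔.domain, ∀ ε > 0, ∃ v : 𝓔.domain,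
    (∃ φ : X → ℝ, Continuous φ ∧ HasCompactSupport φ ∧ ((v : Lp ℝ 2 μ) : X → ℝ) =ᵐ[μ] φ) ∧
    𝓔.form (u - v) (u - v) + ‖(u : Lp ℝ 2 μ) - (v : Lp ℝ 2 μ)‖ ^ 2 < ε) ∧
  (∀ ψ : X → ℝ, Continuous ψ → HasCompactSupport ψ → ∀ ε > 0, ∃ φ : X → ℝ,
    Continuous φ ∧ HasCompactSupport φ ∧
    (∃ v : 𝓔.domain, ((v : Lp ℝ 2 μ) : X → ℝ) =ᵐ[μ] φ) ∧ ∀ x, |ψ x - φ x| < ε)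

/-- The transition function `p_t(x, dy) = P_x(X(t) ∈ dy)` of a (possibly killed) Markov process
with state space `X`: jointly measurable in `(t, x)`, sub-Markov, started at `x` at time `0`, and
satisfying the Chapman-Kolmogorov equations. -/
structure TransitionFunction (X : Type*) [MeasurableSpace X] where
  kernel : Kernel (ℝ≥0 × X) X
  le_one : ∀ t x, kernel (t, x) Set.univ ≤ 1
  zero : ∀ x, kernel (0, x) = Measure.dirac x
  add : ∀ s t x B, MeasurableSet B →
    kernel (s + t, x) B = ∫⁻ y, kernel (t, y) B ∂(kernel (s, x))

namespace TransitionFunction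

section Basic

variable {X : Type*} [MeasurableSpace X]

/-- `p` is `μ`-symmetric. -/
def IsSymmetric (p : TransitionFunction X) (μ : Measure X) : Prop :=
  ∀ (t : ℝ≥0) (A B : Set X), MeasurableSet A → MeasurableSet B →
    ∫⁻ x in A, p.kernel (t, x) B ∂μ = ∫⁻ x in B, p.kernel (t, x) A ∂μ

/-- The approximating form `(1/t) (u - p_t u, v)` in `L²(X, μ)`. -/
noncomputable def approxForm (p : TransitionFunction X) {μ : Measure X} (t : ℝ≥0)
    (u v : Lp ℝ 2 μ) : ℝ :=
  (t : ℝ)⁻¹ * ∫ x, (u x - ∫ y, u y ∂(p.kernel (t, x))) * v x ∂μ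

/-- The `μ`-symmetric transition function `p` and the Dirichlet form `(𝓔, 𝓕)` are associated:
`u ∈ 𝓕` if and only if `(1/t) (u - p_t u, u)` has a finite limit as `t ↓ 0`, and
`𝓔(u, v) = lim_{t ↓ 0} (1/t) (u - p_t u, v)` for `u, v ∈ 𝓕`. -/
def IsAssociated (p : TransitionFunction X) {μ : Measure X} (𝓔 : DirichletForm μ) : Prop :=
  p.IsSymmetric μ ∧
  (∀ u : Lp ℝ 2 μ, u ∈ 𝓔.domain ↔
    ∃ c : ℝ, Tendsto (fun t : ℝ≥0 => p.approxForm t u u) (𝓝[>] 0) (𝓝 c)) ∧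
  (∀ u v : 𝓔.domain, Tendsto (fun t : ℝ≥0 => p.approxForm t (u : Lp ℝ 2 μ) (v : Lp ℝ 2 μ))
    (𝓝[>] 0) (𝓝 (𝓔.form u v)))

/-- The potential `G f(x) = ∫₀^∞ p_t f(x) dt = E_x[∫₀^∞ f(X(t)) dt]` of `f ≥ 0`. -/
noncomputable def green (p : TransitionFunction X) (f : X → ℝ≥0∞) (x : X) : ℝ≥0∞ :=
  ∫⁻ t in Set.Ioi (0 : ℝ), ∫⁻ y, f y ∂(p.kernel (t.toNNReal, x))

/-- The process (or its semigroup) is transient with respect to `μ`: `G f < ∞` `μ`-a.e. for every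
nonnegative `f ∈ L¹(X, μ)`. -/
def IsTransient (p : TransitionFunction X) (μ : Measure X) : Prop :=
  ∀ f : X → ℝ≥0∞, Measurable f → ∫⁻ x, f x ∂μ ≠ ∞ → ∀ᵐ x ∂μ, p.green f x < ∞

end Basic

section Product

variable {ι : Type*} [Fintype ι] {X : ι → Type*} [∀ i, MeasurableSpace (X i)]

theorem isFiniteMeasure_kernel {Y : Type*} [MeasurableSpace Y] (p : TransitionFunction Y)
    (a : ℝ≥0 × Y) : IsFiniteMeasure (p.kernel a) :=
  ⟨(p.le_one a.1 a.2).trans_lt ENNReal.one_lt_top⟩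

theorem lintegral_prod_le_one (ν : ∀ i, Measure (X i)) [∀ i, IsFiniteMeasure (ν i)]
    (g : ∀ i, X i → ℝ≥0∞) (hg : ∀ i, Measurable (g i)) (h1 : ∀ i y, g i y ≤ 1) :
    ∫⁻ y, ∏ i, g i (y i) ∂(Measure.pi ν) = ∏ i, ∫⁻ y, g i y ∂(ν i) := by
  have hne : ∀ i y, g i y ≠ ∞ := fun i y => ((h1 i y).trans_lt ENNReal.one_lt_top).ne
  have hfin : ∀ i, ∫⁻ y, g i y ∂(ν i) ≠ ∞ := fun i =>
    ((lintegral_mono (h1 i)).trans_lt (by simp [measure_lt_top])).ne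
  have hp1 : ∀ y : ∀ i, X i, ∏ i, g i (y i) ≤ 1 := fun y =>
    Finset.prod_le_one' fun i _ => h1 i (y i)
  have hpfin : ∫⁻ y, ∏ i, g i (y i) ∂(Measure.pi ν) ≠ ∞ :=
    ((lintegral_mono hp1).trans_lt (by simp [measure_lt_top])).ne
  have key := integral_fintype_prod_eq_prod (𝕜 := ℝ) (μ := ν) (fun i y => (g i y).toReal)
  rw [← ENNReal.toReal_eq_toReal_iff' hpfin (ENNReal.prod_ne_top fun i _ => hfin i),
    ENNReal.toReal_prod]
  have hmeas : Measurable fun y : ∀ i, X i => ∏ i, g i (y i) :=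
    Finset.measurable_prod _ fun i _ => (hg i).comp (measurable_pi_apply i)
  rw [← integral_toReal hmeas.aemeasurable
    (Eventually.of_forall fun y => (hp1 y).trans_lt ENNReal.one_lt_top)]
  simp only [ENNReal.toReal_prod]
  rw [key]
  refine Finset.prod_congr rfl fun i _ => ?_
  exact integral_toReal (hg i).aemeasurable
    (Eventually.of_forall fun y => (hne i y).lt_top)

/-- The kernel `(t, x) ↦ ⊗ᵢ p⁽ⁱ⁾_t(xᵢ, ·)`. -/
noncomputable def productKernel (p : ∀ i, TransitionFunction (X i)) :
    Kernel (ℝ≥0 × (∀ i, X i)) (∀ i, X i) where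
  toFun a := Measure.pi fun i => (p i).kernel (a.1, a.2 i)
  measurable' := by
    have := fun i a => (p i).isFiniteMeasure_kernel a
    have hm : ∀ i, Measurable fun a : ℝ≥0 × (∀ i, X i) => (a.1, a.2 i) := fun i =>
      measurable_fst.prodMk ((measurable_pi_apply i).comp measurable_snd)
    refine Measurable.measure_of_isPiSystem generateFrom_pi.symm isPiSystem_pi ?_ ?_
    · rintro _ ⟨s, hs, rfl⟩
      simp only [Measure.pi_pi]
      exact Finset.measurable_prod _ fun i _ =>
        ((p i).kernel.measurable_coe (hs i (Set.mem_univ i))).comp (hm i)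
    · simp only [Measure.pi_univ]
      exact Finset.measurable_prod _ fun i _ =>
        ((p i).kernel.measurable_coe MeasurableSet.univ).comp (hm i)

/-- The transition function of the direct product of independent Markov processes with transition
functions `p⁽ⁱ⁾`: started at `x = (xᵢ)`, the law at time `t` is `⊗ᵢ p⁽ⁱ⁾_t(xᵢ, ·)`. -/
noncomputable def product (p : ∀ i, TransitionFunction (X i)) :
    TransitionFunction (∀ i, X i) where
  kernel := productKernel p
  le_one t x := by
    have := fun i a => (p i).isFiniteMeasure_kernel a
    change Measure.pi (fun i => (p i).kernel (t, x i)) Set.univ ≤ 1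
    rw [Measure.pi_univ]
    exact Finset.prod_le_one' fun i _ => (p i).le_one t (x i)
  zero x := by
    change Measure.pi (fun i => (p i).kernel (0, x i)) = _
    simp only [(p _).zero]
    refine Measure.pi_eq fun s hs => ?_
    rw [Measure.dirac_apply' _ (MeasurableSet.univ_pi hs)]
    simp only [Measure.dirac_apply' _ (hs _)]
    classical
    by_cases h : x ∈ Set.univ.pi s
    · rw [Set.indicator_of_mem h]
      symm
      exact Finset.prod_eq_one fun i _ => by
        rw [Set.indicator_of_mem (h i (Set.mem_univ i))]; rfl
    · rw [Set.indicator_of_notMem h]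
      simp only [Set.mem_univ_pi, not_forall] at h
      obtain ⟨i, hi⟩ := h
      exact (Finset.prod_eq_zero (Finset.mem_univ i) (Set.indicator_of_notMem hi _)).symm
  add s t x B hB := by
    have := fun i a => (p i).isFiniteMeasure_kernel a
    have hmk : Measurable fun y : ∀ i, X i => productKernel p (t, y) :=
      (productKernel p).measurable.comp measurable_prodMk_left
    have hpi : Measure.pi (fun i => (p i).kernel (s + t, x i)) =
        Measure.bind (productKernel p (s, x)) fun y => productKernel p (t, y) := by
      refine Measure.pi_eq fun A hA => ?_
      rw [Measure.bind_apply (MeasurableSet.univ_pi hA) hmk.aemeasurable]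
      change ∫⁻ y, Measure.pi (fun i => (p i).kernel (t, y i)) _
        ∂(Measure.pi fun i => (p i).kernel (s, x i)) = _
      simp only [Measure.pi_pi]
      rw [lintegral_prod_le_one (fun i => (p i).kernel (s, x i))
        (fun i y => (p i).kernel (t, y) (A i))
        (fun i => ((p i).kernel.measurable_coe (hA i)).comp measurable_prodMk_left)
        (fun i y => (measure_mono (Set.subset_univ _)).trans ((p i).le_one t y))]
      exact Finset.prod_congr rfl fun i _ => ((p i).add s t (x i) (A i) (hA i)).symm
    change Measure.pi (fun i => (p i).kernel (s + t, x i)) B = _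
    rw [hpi, Measure.bind_apply hB hmk.aemeasurable]

end Product

end TransitionFunction

namespace DirichletForm

variable {X : Type*} [MeasurableSpace X] {μ : Measure X}

/-- The Dirichlet form is transient: an associated Markov process is transient. -/
def IsTransient (𝓔 : DirichletForm μ) : Prop :=
  ∃ p : TransitionFunction X, p.IsAssociated 𝓔 ∧ p.IsTransient μ

/-- The index `n(k) = inf {n ≥ 1 : 𝓔(u_n, u_n) ≤ (1/k) (u_n, u_n)}`, which is `∞ = ⊤` if there is no
such `n`. -/
noncomputable def index (𝓔 : DirichletForm μ) (u : ℕ → 𝓔.domain) (k : ℕ) : ℕ∞ :=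
  sInf {a : ℕ∞ | ∃ n : ℕ, 1 ≤ n ∧ a = n ∧
    𝓔.form (u n) (u n) ≤ 1 / (k : ℝ) * ∫ x, (u n : Lp ℝ 2 μ) x * (u n : Lp ℝ 2 μ) x ∂μ}

/-- The function `u_{n(k)}`, with the convention `u_∞ = 1`. -/
noncomputable def selected (𝓔 : DirichletForm μ) (u : ℕ → 𝓔.domain) (k : ℕ) (x : X) : ℝ :=
  if 𝓔.index u k = ⊤ then 1 else (u (𝓔.index u k).toNat : Lp ℝ 2 μ) x

end DirichletForm

/-! ### Reversible sub-Markov kernels as symmetric contractions -/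

section ReversibleKernel

/-! Write `I(B) = ∫₀^∞ (1_B, p_s 1_B) ds`. The heart of the proof is the capacity-type bound `(∫_B
w)² ≤ 𝓔(w, w) I(B)` for `w ≥ 0` and `m(B), I(B) < ∞` (`sq_setIntegral_le_of_tendsto_approxForm`).
Formally it is Cauchy-Schwarz for `𝓔` applied to `w` and the potential `G 1_B`. Since `G 1_B` need
not lie in `L²`, it is replaced by `∑_{j<n} p_{jt} 1_B`, which `1 - p_t` sends to `1_B - p_{nt}
1_B`; then `n → ∞` and `t ↓ 0`.

If the process were transient, a set `A` of finite positive measure would be covered, up to a null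
set, by the sets `B_n = A ∩ {G 1_A ≤ n}`, for which `I(B_n) ≤ n m(B_n) < ∞`. Functions `0 ≤ w_k ≤ 1`
with `w_k → 1` and energies tending to `0` then force `m(B_n)² ≤ 0` for all `n`, which is absurd
(`not_isTransient_of_tendsto`).

On the product take for `w_k` the tensor product of the selected functions. Both `(w, w)` and `(p_t
w, w)` factor, so the energy of `w_k` is a derivative at `0` of a product
(`exists_tendsto_inv_mul_prod_sub_prod`). The product rule and `𝓔⁽ⁱ⁾(u, u) ≤ (1/k)(u, u)` bound it
by `N/k` times the product of the squared norms, which tends to `0` by assumption. -/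

theorem MeasureTheory.MemLp.integrable_fun_mul {Y : Type*} [MeasurableSpace Y] {ν : Measure Y}
    {u v : Y → ℝ} (hu : MemLp u 2 ν) (hv : MemLp v 2 ν) : Integrable (fun y => u y * v y) ν :=
  hu.integrable_mul hv

theorem integral_add_mul_add_mul {Y : Type*} [MeasurableSpace Y] {ν : Measure Y} {f g h : Y → ℝ}
    (hf : Integrable f ν) (hg : Integrable g ν) (hh : Integrable h ν) (c d : ℝ) :
    ∫ y, (f y + c * g y + d * h y) ∂ν = ∫ y, f y ∂ν + c * ∫ y, g y ∂ν + d * ∫ y, h y ∂ν := by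
  rw [integral_add (f := fun y => f y + c * g y) (hf.add (hg.const_mul c)) (hh.const_mul d),
    integral_add hf (hg.const_mul c), integral_const_mul, integral_const_mul]

variable {X : Type*} [MeasurableSpace X] {m : Measure X} {κ : Kernel X X}

/-- For fixed `B`, reversibility says that two measures coincide: the one with density `κ x B`, and
the image under `κ` of `m` restricted to `B`. Integrating `f` against both settles `g = 1_B`; sums
and monotone limits give every `g`. -/
theorem ProbabilityTheory.Kernel.IsReversible.lintegral_mul_comm (hrev : κ.IsReversible m)
    {f g : X → ℝ≥0∞} (hf : Measurable f) (hg : Measurable g) :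
    ∫⁻ x, f x * ∫⁻ y, g y ∂(κ x) ∂m = ∫⁻ x, g x * ∫⁻ y, f y ∂(κ x) ∂m := by
  have key : ∀ B, MeasurableSet B → ∀ f : X → ℝ≥0∞, Measurable f →
      ∫⁻ x, f x * κ x B ∂m = ∫⁻ x in B, ∫⁻ y, f y ∂(κ x) ∂m := by
    intro B hB f hf
    have hmeq : m.withDensity (fun x => κ x B) = (m.restrict B).bind κ := by
      ext A hA
      rw [withDensity_apply _ hA, Measure.bind_apply hA κ.measurable.aemeasurable]
      exact hrev hA hB
    rw [← Measure.lintegral_bind κ.measurable.aemeasurable hf.aemeasurable, ← hmeq,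
      lintegral_withDensity_eq_lintegral_mul _ (κ.measurable_coe hB) hf]
    simp [mul_comm]
  refine hg.ennreal_induction (motive := fun g => ∫⁻ x, f x * ∫⁻ y, g y ∂(κ x) ∂m =
      ∫⁻ x, g x * ∫⁻ y, f y ∂(κ x) ∂m) ?_ ?_ ?_
  · intro c s hs
    have h1 : ∀ x, f x * ∫⁻ y, s.indicator (fun _ => c) y ∂(κ x) = c * (f x * κ x s) := by
      intro x
      rw [lintegral_indicator_const hs]
      ring
    have h2 : ∀ x, s.indicator (fun _ => c) x * ∫⁻ y, f y ∂(κ x) =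
        s.indicator (fun x => c * ∫⁻ y, f y ∂(κ x)) x := by
      intro x
      by_cases hx : x ∈ s <;> simp [hx]
    simp_rw [h1, h2]
    have hF : Measurable fun x => f x * κ x s := hf.mul (κ.measurable_coe hs)
    rw [lintegral_const_mul _ hF, key s hs f hf,
      lintegral_indicator hs, lintegral_const_mul _ hf.lintegral_kernel]
  · intro g₁ g₂ _ h₁ h₂ ih₁ ih₂
    simp only [Pi.add_apply, add_mul]
    have hF : Measurable fun x => g₁ x * ∫⁻ y, f y ∂(κ x) := h₁.mul hf.lintegral_kernel
    have hG : Measurable fun x => f x * ∫⁻ y, g₁ y ∂(κ x) := hf.mul h₁.lintegral_kernel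
    rw [lintegral_add_left hF, ← ih₁, ← ih₂, ← lintegral_add_left hG]
    refine lintegral_congr fun x => ?_
    rw [lintegral_add_left h₁, mul_add]
  · intro g hg hmono ih
    have h1 : ∀ x, f x * ∫⁻ y, (⨆ n, g n y) ∂(κ x) = ⨆ n, f x * ∫⁻ y, g n y ∂(κ x) := by
      intro x
      rw [lintegral_iSup hg hmono, ENNReal.mul_iSup]
    have h2 : ∀ x, (⨆ n, g n x) * ∫⁻ y, f y ∂(κ x) = ⨆ n, g n x * ∫⁻ y, f y ∂(κ x) := by
      intro x
      rw [ENNReal.iSup_mul]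
    simp_rw [h1, h2]
    have hF : ∀ n, Measurable fun x => f x * ∫⁻ y, g n y ∂(κ x) := fun n =>
      hf.mul (hg n).lintegral_kernel
    have hG : ∀ n, Measurable fun x => g n x * ∫⁻ y, f y ∂(κ x) := fun n =>
      (hg n).mul hf.lintegral_kernel
    rw [lintegral_iSup hF, lintegral_iSup hG]
    · simp_rw [ih]
    · intro i j hij x
      exact mul_le_mul_left (hmono hij x) _
    · intro i j hij x
      exact mul_le_mul_right (lintegral_mono (hmono hij)) _

theorem ProbabilityTheory.Kernel.IsReversible.lintegral_lintegral_le (hrev : κ.IsReversible m)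
    (h1 : ∀ x, κ x Set.univ ≤ 1) {f : X → ℝ≥0∞} (hf : Measurable f) :
    ∫⁻ x, ∫⁻ y, f y ∂(κ x) ∂m ≤ ∫⁻ x, f x ∂m := by
  have := hrev.lintegral_mul_comm (f := fun _ => 1) measurable_const hf
  simp only [one_mul] at this
  rw [this]
  exact lintegral_mono fun x => mul_le_of_le_one_right' (by simpa using h1 x)

theorem sq_lintegral_le_lintegral_sq {ν : Measure X} (h1 : ν Set.univ ≤ 1) {f : X → ℝ≥0∞}
    (hf : Measurable f) : (∫⁻ x, f x ∂ν) ^ 2 ≤ ∫⁻ x, f x ^ 2 ∂ν := by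
  have h := ENNReal.lintegral_mul_le_Lp_mul_Lq ν Real.HolderConjugate.two_two hf.aemeasurable
    (aemeasurable_const (b := (1 : ℝ≥0∞)))
  simp only [Pi.mul_apply, mul_one, ENNReal.one_rpow, lintegral_const, one_mul] at h
  have h2 : ∫⁻ x, f x ∂ν ≤ (∫⁻ x, f x ^ (2 : ℝ) ∂ν) ^ (1 / 2 : ℝ) :=
    h.trans (mul_le_of_le_one_right' (ENNReal.rpow_le_one h1 (by norm_num)))
  calc (∫⁻ x, f x ∂ν) ^ 2 ≤ ((∫⁻ x, f x ^ (2 : ℝ) ∂ν) ^ (1 / 2 : ℝ)) ^ 2 := by gcongr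
    _ = ∫⁻ x, f x ^ 2 ∂ν := by
      rw [← ENNReal.rpow_natCast, ← ENNReal.rpow_mul]
      simp

theorem ProbabilityTheory.Kernel.IsReversible.lintegral_sq_lintegral_le
    (hrev : κ.IsReversible m) (h1 : ∀ x, κ x Set.univ ≤ 1) {f : X → ℝ≥0∞} (hf : Measurable f) :
    ∫⁻ x, (∫⁻ y, f y ∂(κ x)) ^ 2 ∂m ≤ ∫⁻ x, f x ^ 2 ∂m :=
  (lintegral_mono fun x => sq_lintegral_le_lintegral_sq (h1 x) hf).trans
    (hrev.lintegral_lintegral_le h1 (hf.pow_const 2))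

variable [SFinite m] [IsFiniteKernel κ]

/-- Both marginals of `m ⊗ₘ κ` are dominated by `m`. Hence `(u, κ v)` can be treated as the integral
of `u(x) v(y)` on `X × X`, with both factors in `L²`. -/
theorem map_fst_compProd_le (h1 : ∀ x, κ x Set.univ ≤ 1) :
    (m ⊗ₘ κ).map Prod.fst ≤ m := by
  refine Measure.le_iff.2 fun s hs => ?_
  rw [Measure.map_apply measurable_fst hs, show Prod.fst ⁻¹' s = s ×ˢ (Set.univ : Set X) by
    ext; simp, Measure.compProd_apply_prod hs MeasurableSet.univ]
  exact (lintegral_mono fun x => h1 x).trans (by simp)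

theorem ProbabilityTheory.Kernel.IsReversible.map_snd_compProd_le (hrev : κ.IsReversible m)
    (h1 : ∀ x, κ x Set.univ ≤ 1) : (m ⊗ₘ κ).map Prod.snd ≤ m := by
  refine Measure.le_iff.2 fun s hs => ?_
  rw [Measure.map_apply measurable_snd hs, show Prod.snd ⁻¹' s = (Set.univ : Set X) ×ˢ s by
    ext; simp, Measure.compProd_apply_prod MeasurableSet.univ hs, hrev MeasurableSet.univ hs]
  exact (lintegral_mono fun x => h1 x).trans (by simp)

/-- The second marginal of `m ⊗ₘ κ` does not charge `m`-null sets, so `κ` acts on classes modulo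
`m`. -/
theorem ProbabilityTheory.Kernel.IsReversible.ae_ae_eq (hrev : κ.IsReversible m)
    (h1 : ∀ x, κ x Set.univ ≤ 1) {f g : X → ℝ} (h : f =ᵐ[m] g) :
    ∀ᵐ x ∂m, f =ᵐ[κ x] g := by
  have h2 : ∀ᵐ y ∂((m ⊗ₘ κ).map Prod.snd), f y = g y :=
    (Measure.absolutelyContinuous_of_le (hrev.map_snd_compProd_le h1)).ae_le h
  exact Measure.ae_ae_of_ae_compProd (ae_of_ae_map measurable_snd.aemeasurable h2)

theorem memLp_fst_compProd (h1 : ∀ x, κ x Set.univ ≤ 1) {u : X → ℝ} (hu : MemLp u 2 m) :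
    MemLp (fun z : X × X => u z.1) 2 (m ⊗ₘ κ) :=
  (hu.mono_measure (map_fst_compProd_le h1)).comp_of_map measurable_fst.aemeasurable

theorem ProbabilityTheory.Kernel.IsReversible.memLp_snd_compProd (hrev : κ.IsReversible m)
    (h1 : ∀ x, κ x Set.univ ≤ 1) {u : X → ℝ} (hu : MemLp u 2 m) :
    MemLp (fun z : X × X => u z.2) 2 (m ⊗ₘ κ) :=
  (hu.mono_measure (hrev.map_snd_compProd_le h1)).comp_of_map measurable_snd.aemeasurable

theorem ProbabilityTheory.Kernel.IsReversible.integrable_mul_compProd (hrev : κ.IsReversible m)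
    (h1 : ∀ x, κ x Set.univ ≤ 1) {u v : X → ℝ} (hu : MemLp u 2 m) (hv : MemLp v 2 m) :
    Integrable (fun z : X × X => u z.1 * v z.2) (m ⊗ₘ κ) :=
  (memLp_fst_compProd h1 hu).integrable_fun_mul (hrev.memLp_snd_compProd h1 hv)

theorem ProbabilityTheory.Kernel.IsReversible.integrable_mul_integral (hrev : κ.IsReversible m)
    (h1 : ∀ x, κ x Set.univ ≤ 1) {u v : X → ℝ} (hu : MemLp u 2 m) (hv : MemLp v 2 m) :
    Integrable (fun x => u x * ∫ y, v y ∂(κ x)) m := by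
  have := Integrable.integral_compProd (κ := Kernel.const Unit m) (η := Kernel.prodMkLeft Unit κ)
    (a := ()) (hrev.integrable_mul_compProd h1 hu hv)
  simpa [integral_const_mul] using this

theorem ProbabilityTheory.Kernel.IsReversible.integral_mul_integral (hrev : κ.IsReversible m)
    (h1 : ∀ x, κ x Set.univ ≤ 1) {u v : X → ℝ} (hu : MemLp u 2 m) (hv : MemLp v 2 m) :
    ∫ x, u x * ∫ y, v y ∂(κ x) ∂m = ∫ z, u z.1 * v z.2 ∂(m ⊗ₘ κ) := by
  rw [Measure.integral_compProd (hrev.integrable_mul_compProd h1 hu hv)]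
  simp only [integral_const_mul]

theorem ProbabilityTheory.Kernel.IsReversible.integral_sub_mul (hrev : κ.IsReversible m)
    (h1 : ∀ x, κ x Set.univ ≤ 1) {u v : X → ℝ} (hu : MemLp u 2 m) (hv : MemLp v 2 m) :
    ∫ x, (u x - ∫ y, u y ∂(κ x)) * v x ∂m =
      ∫ x, u x * v x ∂m - ∫ x, v x * ∫ y, u y ∂(κ x) ∂m := by
  rw [← integral_sub (hu.integrable_fun_mul hv) (hrev.integrable_mul_integral h1 hv hu)]
  exact integral_congr_ae (.of_forall fun x => by ring)

theorem ProbabilityTheory.Kernel.IsReversible.integral_mul_integral_comm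
    (hrev : κ.IsReversible m) (h1 : ∀ x, κ x Set.univ ≤ 1) {u v : X → ℝ}
    (hu : MemLp u 2 m) (hv : MemLp v 2 m) (hum : Measurable u) (hvm : Measurable v)
    (hu0 : 0 ≤ u) (hv0 : 0 ≤ v) :
    ∫ x, u x * ∫ y, v y ∂(κ x) ∂m = ∫ x, v x * ∫ y, u y ∂(κ x) ∂m := by
  have key : ∀ {u v : X → ℝ}, MemLp u 2 m → MemLp v 2 m → Measurable u → Measurable v →
      0 ≤ u → 0 ≤ v → ∫ x, u x * ∫ y, v y ∂(κ x) ∂m =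
        (∫⁻ x, ENNReal.ofReal (u x) * ∫⁻ y, ENNReal.ofReal (v y) ∂(κ x) ∂m).toReal := by
    intro u v hu hv hum hvm hu0 hv0
    rw [hrev.integral_mul_integral h1 hu hv, integral_eq_lintegral_of_nonneg_ae
      (.of_forall fun z => mul_nonneg (hu0 _) (hv0 _))
      (hrev.integrable_mul_compProd h1 hu hv).aestronglyMeasurable,
      Measure.lintegral_compProd (by fun_prop)]
    congr 1
    refine lintegral_congr fun x => ?_
    rw [← lintegral_const_mul _ (by fun_prop)]
    exact lintegral_congr fun y => ENNReal.ofReal_mul (hu0 x)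
  rw [key hu hv hum hvm hu0 hv0, key hv hu hvm hum hv0 hu0,
    hrev.lintegral_mul_comm hum.ennreal_ofReal hvm.ennreal_ofReal]

/-- Integrate `u(x) u(y) ≤ (u(x)² + u(y)²) / 2` against `m ⊗ₘ κ` and use that both marginals are at
most `m`. This is the positivity of `1 - κ`. -/
theorem ProbabilityTheory.Kernel.IsReversible.integral_mul_integral_self_le
    (hrev : κ.IsReversible m) (h1 : ∀ x, κ x Set.univ ≤ 1) {u : X → ℝ} (hu : MemLp u 2 m) :
    ∫ x, u x * ∫ y, u y ∂(κ x) ∂m ≤ ∫ x, u x * u x ∂m := by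
  have hfst := memLp_fst_compProd h1 hu
  have hsnd := hrev.memLp_snd_compProd h1 hu
  have hle : ∀ {ν : Measure X}, ν ≤ m → ∫ x, u x * u x ∂ν ≤ ∫ x, u x * u x ∂m := fun h =>
    integral_mono_measure h (.of_forall fun x => mul_self_nonneg _) (hu.integrable_fun_mul hu)
  have h2 : ∫ z, u z.1 * u z.1 ∂(m ⊗ₘ κ) ≤ ∫ x, u x * u x ∂m := by
    refine le_trans (le_of_eq ?_) (hle (map_fst_compProd_le h1))
    rw [integral_map measurable_fst.aemeasurable]
    exact ((hu.mono_measure (map_fst_compProd_le h1)).integrable_fun_mul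
      (hu.mono_measure (map_fst_compProd_le h1))).aestronglyMeasurable
  have h3 : ∫ z, u z.2 * u z.2 ∂(m ⊗ₘ κ) ≤ ∫ x, u x * u x ∂m := by
    refine le_trans (le_of_eq ?_) (hle (hrev.map_snd_compProd_le h1))
    rw [integral_map measurable_snd.aemeasurable]
    exact ((hu.mono_measure (hrev.map_snd_compProd_le h1)).integrable_fun_mul
      (hu.mono_measure (hrev.map_snd_compProd_le h1))).aestronglyMeasurable
  rw [hrev.integral_mul_integral h1 hu hu]
  have h4 : ∫ z, u z.1 * u z.2 ∂(m ⊗ₘ κ) ≤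
      ∫ z, (2⁻¹ * (u z.1 * u z.1) + 2⁻¹ * (u z.2 * u z.2)) ∂(m ⊗ₘ κ) := by
    refine integral_mono (hrev.integrable_mul_compProd h1 hu hu)
      (((hfst.integrable_fun_mul hfst).const_mul _).add ((hsnd.integrable_fun_mul hsnd).const_mul _))
      fun z => ?_
    change u z.1 * u z.2 ≤ 2⁻¹ * (u z.1 * u z.1) + 2⁻¹ * (u z.2 * u z.2)
    nlinarith [sq_nonneg (u z.1 - u z.2)]
  rw [integral_add ((hfst.integrable_fun_mul hfst).const_mul _)
    ((hsnd.integrable_fun_mul hsnd).const_mul _), integral_const_mul, integral_const_mul] at h4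
  linarith

/-- The Cauchy-Schwarz inequality for the form `(u - κ u, v)`. -/
theorem ProbabilityTheory.Kernel.IsReversible.sq_integral_sub_mul_le
    (hrev : κ.IsReversible m) (h1 : ∀ x, κ x Set.univ ≤ 1) {u v : X → ℝ}
    (hu : MemLp u 2 m) (hv : MemLp v 2 m) (hum : Measurable u) (hvm : Measurable v)
    (hu0 : 0 ≤ u) (hv0 : 0 ≤ v) :
    (∫ x, (v x - ∫ y, v y ∂(κ x)) * u x ∂m) ^ 2 ≤
      (∫ x, (u x - ∫ y, u y ∂(κ x)) * u x ∂m) * ∫ x, (v x - ∫ y, v y ∂(κ x)) * v x ∂m := by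
  have hsymm := hrev.integral_mul_integral_comm h1 hu hv hum hvm hu0 hv0
  rw [hrev.integral_sub_mul h1 hv hu, hrev.integral_sub_mul h1 hu hu,
    hrev.integral_sub_mul h1 hv hv]
  -- The form evaluated at `u + c v` is a nonnegative quadratic polynomial in `c`; the claim is that
  -- its discriminant is at most `0`.
  have hquad : ∀ c : ℝ, 0 ≤ (∫ x, v x * v x ∂m - ∫ x, v x * ∫ y, v y ∂(κ x) ∂m) * (c * c) +
      (2 * (∫ x, v x * u x ∂m - ∫ x, u x * ∫ y, v y ∂(κ x) ∂m)) * c +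
      (∫ x, u x * u x ∂m - ∫ x, u x * ∫ y, u y ∂(κ x) ∂m) := by
    intro c
    have hw : MemLp (fun x => u x + c * v x) 2 m := hu.add (hv.const_mul c)
    have h := hrev.integral_mul_integral_self_le h1 hw
    rw [hrev.integral_mul_integral h1 hw hw] at h
    have e1 : ∫ z, (u z.1 + c * v z.1) * (u z.2 + c * v z.2) ∂(m ⊗ₘ κ) =
        ∫ x, u x * ∫ y, u y ∂(κ x) ∂m + c * (2 * ∫ x, u x * ∫ y, v y ∂(κ x) ∂m) +
        c * c * ∫ x, v x * ∫ y, v y ∂(κ x) ∂m := by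
      rw [two_mul]
      conv_rhs =>
        enter [1, 2, 2, 2]
        rw [hsymm]
      rw [hrev.integral_mul_integral h1 hu hu, hrev.integral_mul_integral h1 hu hv,
        hrev.integral_mul_integral h1 hv hu, hrev.integral_mul_integral h1 hv hv,
        ← integral_add (hrev.integrable_mul_compProd h1 hu hv)
          (hrev.integrable_mul_compProd h1 hv hu),
        ← integral_add_mul_add_mul (hrev.integrable_mul_compProd h1 hu hu)
          (g := fun z => u z.1 * v z.2 + v z.1 * u z.2)
          ((hrev.integrable_mul_compProd h1 hu hv).add (hrev.integrable_mul_compProd h1 hv hu))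
          (hrev.integrable_mul_compProd h1 hv hv)]
      exact integral_congr_ae (.of_forall fun z => by ring)
    have e2 : ∫ x, (u x + c * v x) * (u x + c * v x) ∂m =
        ∫ x, u x * u x ∂m + c * 2 * ∫ x, v x * u x ∂m + c * c * ∫ x, v x * v x ∂m := by
      rw [← integral_add_mul_add_mul (hu.integrable_fun_mul hu) (hv.integrable_fun_mul hu)
        (hv.integrable_fun_mul hv)]
      exact integral_congr_ae (.of_forall fun z => by ring)
    rw [e1, e2] at h
    linarith
  have := discrim_le_zero hquad
  rw [discrim] at this
  nlinarith

end ReversibleKernel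

/-! ### The energy bound and the criterion for non-transience -/

namespace TransitionFunction

section Transience

variable {X : Type*} [MeasurableSpace X] (p : TransitionFunction X) {m : Measure X}

/-- The kernel `x ↦ p_t(x, ·)`. -/
noncomputable def atTime (t : ℝ≥0) : Kernel X X :=
  p.kernel.comap (Prod.mk t) measurable_prodMk_left

theorem atTime_apply (t : ℝ≥0) (x : X) : p.atTime t x = p.kernel (t, x) := rfl

theorem atTime_univ_le_one (t : ℝ≥0) (x : X) : p.atTime t x Set.univ ≤ 1 := p.le_one t x

instance (t : ℝ≥0) : IsFiniteKernel (p.atTime t) := ⟨1, ENNReal.one_lt_top, p.le_one t⟩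

theorem atTime_le_one (t : ℝ≥0) (x : X) (B : Set X) : p.atTime t x B ≤ 1 :=
  (measure_mono (Set.subset_univ B)).trans (p.le_one t x)

variable {p}

theorem IsSymmetric.isReversible (hp : p.IsSymmetric m) (t : ℝ≥0) :
    (p.atTime t).IsReversible m := fun _ _ hA hB => hp t _ _ hA hB

theorem atTime_add (s t : ℝ≥0) (x : X) {B : Set X} (hB : MeasurableSet B) :
    p.atTime (s + t) x B = ∫⁻ y, p.atTime t y B ∂(p.atTime s x) := p.add s t x B hB

/-- Split `p_{2s} = p_s p_s` and move one factor across by symmetry: `(1_B, p_{2s} 1_B) = ‖p_s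
1_B‖²`. -/
theorem setLIntegral_atTime_add_self (hp : p.IsSymmetric m) (s : ℝ≥0) {B : Set X}
    (hB : MeasurableSet B) :
    ∫⁻ x in B, p.atTime (s + s) x B ∂m = ∫⁻ x, (p.atTime s x B) ^ 2 ∂m := by
  have h := (hp.isReversible s).lintegral_mul_comm
    (f := B.indicator fun _ => 1) (measurable_const.indicator hB)
    ((p.atTime s).measurable_coe hB)
  simp only [lintegral_indicator_const hB, one_mul] at h
  simp_rw [sq]
  rw [← h, ← lintegral_indicator hB]
  refine lintegral_congr fun x => ?_
  by_cases hx : x ∈ B <;> simp [hx, p.atTime_add s s x hB]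

/-- By the preceding identity the value at `s` is `‖p_{s/2} 1_B‖²`, and each `p_{r/2}` contracts
`L²`. -/
theorem antitone_setLIntegral_atTime (hp : p.IsSymmetric m) {B : Set X} (hB : MeasurableSet B) :
    Antitone fun s => ∫⁻ x in B, p.atTime s x B ∂m := by
  intro s s' hs
  obtain ⟨r, rfl⟩ := exists_add_of_le hs
  have e1 : s = s / 2 + s / 2 := (add_halves s).symm
  have e2 : s + r = (r / 2 + s / 2) + (r / 2 + s / 2) := by
    rw [add_add_add_comm, add_halves, add_halves, add_comm]
  change ∫⁻ x in B, p.atTime (s + r) x B ∂m ≤ ∫⁻ x in B, p.atTime s x B ∂m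
  rw [e2, setLIntegral_atTime_add_self hp _ hB]
  conv_rhs => rw [e1, setLIntegral_atTime_add_self hp _ hB]
  simp_rw [p.atTime_add (r / 2) (s / 2) _ hB]
  exact (hp.isReversible _).lintegral_sq_lintegral_le (p.atTime_univ_le_one _)
    ((p.atTime _).measurable_coe hB)

theorem setLIntegral_atTime_le (s : ℝ≥0) (B : Set X) :
    ∫⁻ x in B, p.atTime s x B ∂m ≤ m B :=
  (lintegral_mono fun x => p.atTime_le_one s x B).trans (by simp)

/-- Comparison of a decreasing function with its integral: the term at `j ≥ 1` is at most the
integral over the interval of length `t` ending at `j t`, and the term at `j = 0` costs at most `t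
m(B)`. -/
theorem sum_setLIntegral_atTime_le (hp : p.IsSymmetric m) {B : Set X} (hB : MeasurableSet B)
    (t : ℝ≥0) (n : ℕ) :
    t * ∑ j ∈ Finset.range n, ∫⁻ x in B, p.atTime (j * t) x B ∂m ≤
      t * m B + ∫⁻ s in Set.Ioi (0 : ℝ), ∫⁻ x in B, p.atTime s.toNNReal x B ∂m := by
  set φ : ℝ≥0 → ℝ≥0∞ := fun s => ∫⁻ x in B, p.atTime s x B ∂m with hφ
  have hanti : Antitone φ := antitone_setLIntegral_atTime hp hB
  have h1 : ∀ n : ℕ, ∑ j ∈ Finset.range n, t * φ ((j + 1 : ℕ) * t) ≤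
      ∫⁻ s in Set.Ioc (0 : ℝ) (n * t), φ s.toNNReal := by
    intro n
    induction n with
    | zero => simp
    | succ n ih =>
      have hle : (n : ℝ) * t ≤ ((n + 1 : ℕ) : ℝ) * t := by
        gcongr
        simp
      rw [Finset.sum_range_succ, ← Set.Ioc_union_Ioc_eq_Ioc (by positivity) hle,
        lintegral_union measurableSet_Ioc (Set.Ioc_disjoint_Ioc_of_le le_rfl)]
      refine add_le_add ih ?_
      calc (t : ℝ≥0∞) * φ ((n + 1 : ℕ) * t)
          = ∫⁻ s in Set.Ioc ((n : ℝ) * t) ((n + 1 : ℕ) * t), φ ((n + 1 : ℕ) * t) := by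
            rw [setLIntegral_const, Real.volume_Ioc, mul_comm]
            congr 1
            rw [show ((n + 1 : ℕ) : ℝ) * t - n * t = t by push_cast; ring]
            simp
        _ ≤ _ := by
            refine setLIntegral_mono' measurableSet_Ioc fun s hs => hanti ?_
            rw [Real.toNNReal_le_iff_le_coe]
            push_cast
            simpa using hs.2
  rw [Finset.mul_sum]
  cases n with
  | zero => simp
  | succ n =>
    rw [Finset.sum_range_succ', add_comm]
    refine add_le_add ?_ ((h1 n).trans (lintegral_mono_set Set.Ioc_subset_Ioi_self))
    gcongr
    exact setLIntegral_atTime_le _ B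

theorem tendsto_setLIntegral_atTime (hp : p.IsSymmetric m) {B : Set X} (hB : MeasurableSet B)
    (hmB : m B ≠ ∞)
    (hI : ∫⁻ s in Set.Ioi (0 : ℝ), ∫⁻ x in B, p.atTime s.toNNReal x B ∂m ≠ ∞)
    {t : ℝ≥0} (ht : 0 < t) :
    Tendsto (fun n : ℕ => ∫⁻ x in B, p.atTime (n * t) x B ∂m) atTop (𝓝 0) := by
  refine ENNReal.tendsto_atTop_zero_of_tsum_ne_top ?_
  have ht0 : (t : ℝ≥0∞) ≠ 0 := by simpa using ht.ne'
  have h : t * ∑' j : ℕ, ∫⁻ x in B, p.atTime (j * t) x B ∂m ≤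
      t * m B + ∫⁻ s in Set.Ioi (0 : ℝ), ∫⁻ x in B, p.atTime s.toNNReal x B ∂m := by
    rw [ENNReal.tsum_eq_iSup_nat, ENNReal.mul_iSup]
    exact iSup_le fun n => sum_setLIntegral_atTime_le hp hB t n
  intro htop
  rw [htop, ENNReal.mul_top ht0, top_le_iff] at h
  exact ENNReal.add_ne_top.2 ⟨ENNReal.mul_ne_top ENNReal.coe_ne_top hmB, hI⟩ h

theorem memLp_atTime (hp : p.IsSymmetric m) {B : Set X} (hB : MeasurableSet B) (hmB : m B ≠ ∞)
    (s : ℝ≥0) : MemLp (fun x => (p.atTime s x B).toReal) 2 m := by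
  have hmeas : Measurable fun x => (p.atTime s x B).toReal :=
    ((p.atTime s).measurable_coe hB).ennreal_toReal
  rw [memLp_two_iff_integrable_sq hmeas.aestronglyMeasurable]
  simp_rw [← ENNReal.toReal_pow]
  refine integrable_toReal_of_lintegral_ne_top
    (((p.atTime s).measurable_coe hB).pow_const 2).aemeasurable ?_
  rw [← setLIntegral_atTime_add_self hp s hB]
  exact ne_top_of_le_ne_top hmB (setLIntegral_atTime_le _ B)

/-- By Cauchy-Schwarz it suffices that `‖p_{nt} 1_B‖² = (1_B, p_{2nt} 1_B)` tends to `0`, and this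
is the general term of a convergent series with step `2t`. -/
theorem tendsto_integral_atTime_mul (hp : p.IsSymmetric m) {B : Set X} (hB : MeasurableSet B)
    (hmB : m B ≠ ∞)
    (hI : ∫⁻ s in Set.Ioi (0 : ℝ), ∫⁻ x in B, p.atTime s.toNNReal x B ∂m ≠ ∞)
    {t : ℝ≥0} (ht : 0 < t) {w : X → ℝ} (hw : MemLp w 2 m) (hw0 : 0 ≤ w) :
    Tendsto (fun n : ℕ => ∫ x, (p.atTime (n * t) x B).toReal * w x ∂m) atTop (𝓝 0) := by
  have h1 : ∀ n : ℕ, ∫ x, (p.atTime (n * t) x B).toReal * w x ∂m ≤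
      (∫⁻ x in B, p.atTime (n * (2 * t)) x B ∂m).toReal ^ (1 / 2 : ℝ) *
        (∫ x, w x ^ (2 : ℝ) ∂m) ^ (1 / 2 : ℝ) := by
    intro n
    refine (integral_mul_le_Lp_mul_Lq_of_nonneg Real.HolderConjugate.two_two
      (.of_forall fun x => ENNReal.toReal_nonneg) (.of_forall hw0)
      (by simpa using memLp_atTime hp hB hmB _) (by simpa using hw)).trans (le_of_eq ?_)
    congr 2
    simp only [Real.rpow_ofNat]
    rw [show (n * (2 * t) : ℝ≥0) = n * t + n * t by ring, setLIntegral_atTime_add_self hp _ hB,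
      ← integral_toReal (((p.atTime _).measurable_coe hB).pow_const 2).aemeasurable]
    · simp
    · exact .of_forall fun x => ENNReal.pow_lt_top
        ((p.atTime_le_one _ x B).trans_lt ENNReal.one_lt_top)
  refine squeeze_zero (fun n => integral_nonneg fun x => mul_nonneg ENNReal.toReal_nonneg (hw0 x))
    h1 ?_
  have h2 := (ENNReal.tendsto_toReal ENNReal.zero_ne_top).comp
    (tendsto_setLIntegral_atTime hp hB hmB hI (t := 2 * t) (by positivity))
  have h3 := (h2.rpow_const (p := 1 / 2) (Or.inr (by norm_num))).mul_const
    ((∫ x, w x ^ (2 : ℝ) ∂m) ^ (1 / 2 : ℝ))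
  simpa using h3

theorem integral_atTime (s t : ℝ≥0) (x : X) {B : Set X} (hB : MeasurableSet B) :
    ∫ y, (p.atTime s y B).toReal ∂(p.atTime t x) = (p.atTime (t + s) x B).toReal := by
  rw [integral_toReal ((p.atTime s).measurable_coe hB).aemeasurable
    (.of_forall fun y => (p.atTime_le_one s y B).trans_lt ENNReal.one_lt_top),
    p.atTime_add t s x hB]

theorem atTime_zero_toReal (x : X) {B : Set X} (hB : MeasurableSet B) :
    (p.atTime 0 x B).toReal = B.indicator (fun _ => 1) x := by
  rw [p.atTime_apply, p.zero, Measure.dirac_apply' _ hB]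
  by_cases hx : x ∈ B <;> simp [hx]

variable [SFinite m]

theorem approxForm_self_eq (hp : p.IsSymmetric m) (t : ℝ≥0) {U : Lp ℝ 2 m} {v : X → ℝ}
    (h : U =ᵐ[m] v) :
    p.approxForm t U U = (t : ℝ)⁻¹ * ∫ x, (v x - ∫ y, v y ∂(p.atTime t x)) * v x ∂m := by
  unfold approxForm
  congr 1
  refine integral_congr_ae ?_
  filter_upwards [h, (hp.isReversible t).ae_ae_eq (p.atTime_univ_le_one t) h] with x hx hx2
  rw [← p.atTime_apply, integral_congr_ae hx2, hx]

/-- Cauchy-Schwarz for `(u - p_t u, v)` between `w` and the discrete potential `S = ∑_{j<n} p_{jt}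
1_B`. The bound does not depend on `n`. -/
theorem integral_indicator_sub_atTime_mul_sq_le (hp : p.IsSymmetric m) {B : Set X}
    (hB : MeasurableSet B) (hmB : m B ≠ ∞)
    (hI : ∫⁻ s in Set.Ioi (0 : ℝ), ∫⁻ x in B, p.atTime s.toNNReal x B ∂m ≠ ∞)
    {t : ℝ≥0} (ht : 0 < t) {w : X → ℝ} (hw : MemLp w 2 m) (hwm : Measurable w) (hw0 : 0 ≤ w)
    (n : ℕ) :
    (∫ x in B, w x ∂m - ∫ x, (p.atTime (n * t) x B).toReal * w x ∂m) ^ 2 ≤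
      ((t : ℝ)⁻¹ * ∫ x, (w x - ∫ y, w y ∂(p.atTime t x)) * w x ∂m) *
      (t * (m B).toReal +
        (∫⁻ s in Set.Ioi (0 : ℝ), ∫⁻ x in B, p.atTime s.toNNReal x B ∂m).toReal) := by
  set h : ℕ → X → ℝ := fun j x => (p.atTime (j * t) x B).toReal with hh
  have hL : ∀ j, MemLp (h j) 2 m := fun j => memLp_atTime hp hB hmB _
  have hm : ∀ j, Measurable (h j) := fun j => ((p.atTime _).measurable_coe hB).ennreal_toReal
  have hnn : ∀ j x, 0 ≤ h j x := fun j x => ENNReal.toReal_nonneg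
  set S : X → ℝ := fun x => ∑ j ∈ Finset.range n, h j x with hS
  have hSL : MemLp S 2 m := memLp_finsetSum _ fun j _ => hL j
  have hSm : Measurable S := Finset.measurable_sum _ fun j _ => hm j
  have hS0 : 0 ≤ S := fun x => Finset.sum_nonneg fun j _ => hnn j x
  -- `p_t` shifts the index of each summand by one, so the sum telescopes.
  have hdiff : ∀ x, S x - ∫ y, S y ∂(p.atTime t x) = h 0 x - h n x := by
    intro x
    have hint : ∀ j, Integrable (h j) (p.atTime t x) := fun j =>
      Integrable.of_bound (C := 1) (hm j).aestronglyMeasurable <| .of_forall fun y => by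
        rw [Real.norm_of_nonneg (hnn j y)]
        exact ENNReal.toReal_le_of_le_ofReal zero_le_one (by simpa using p.atTime_le_one _ y B)
    rw [integral_finsetSum _ fun j _ => hint j, hS, ← Finset.sum_sub_distrib,
      ← Finset.sum_range_sub' (fun j => h j x)]
    refine Finset.sum_congr rfl fun j _ => ?_
    rw [hh, integral_atTime _ _ _ hB]
    rw [show t + j * t = ((j + 1 : ℕ) : ℝ≥0) * t by push_cast; ring]
  have hzero : h 0 = B.indicator fun _ => 1 := by
    ext x
    simpa [hh] using atTime_zero_toReal x hB
  have hmul : ∀ v : X → ℝ, (fun x => h 0 x * v x) = B.indicator v := by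
    intro v
    rw [hzero]
    ext x
    by_cases hx : x ∈ B <;> simp [hx]
  have hcs := (hp.isReversible t).sq_integral_sub_mul_le (p.atTime_univ_le_one t) hw hSL hwm hSm
    hw0 hS0
  have hsplit : ∀ {v : X → ℝ}, MemLp v 2 m → ∫ x, (h 0 x - h n x) * v x ∂m =
      ∫ x in B, v x ∂m - ∫ x, h n x * v x ∂m := by
    intro v hvL
    simp_rw [sub_mul]
    rw [integral_sub ((hL 0).integrable_fun_mul hvL) ((hL n).integrable_fun_mul hvL), hmul,
      integral_indicator hB]
  simp_rw [hdiff] at hcs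
  rw [hsplit hw] at hcs
  have hnonneg : 0 ≤ ∫ x, (w x - ∫ y, w y ∂(p.atTime t x)) * w x ∂m := by
    rw [(hp.isReversible t).integral_sub_mul (p.atTime_univ_le_one t) hw hw]
    exact sub_nonneg.2
      ((hp.isReversible t).integral_mul_integral_self_le (p.atTime_univ_le_one t) hw)
  -- The term with `h n` only helps, being subtracted and nonnegative; what remains is `(1_B, S)`,
  -- bounded by the sum-integral comparison.
  have hbound : ∫ x, (h 0 x - h n x) * S x ∂m ≤ (t : ℝ)⁻¹ * (t * (m B).toReal +
        (∫⁻ s in Set.Ioi (0 : ℝ), ∫⁻ x in B, p.atTime s.toNNReal x B ∂m).toReal) := by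
    rw [hsplit hSL]
    have h1 : 0 ≤ ∫ x, h n x * S x ∂m := integral_nonneg fun x => mul_nonneg (hnn n x) (hS0 x)
    have h2 : ∫ x in B, S x ∂m = (∑ j ∈ Finset.range n,
        ∫⁻ x in B, p.atTime (j * t) x B ∂m).toReal := by
      have hBfin : IsFiniteMeasure (m.restrict B) :=
        ⟨by simpa using hmB.lt_top⟩
      rw [integral_finsetSum _ fun j _ => ((hL j).restrict B).integrable one_le_two,
        ENNReal.toReal_sum fun j _ => ne_top_of_le_ne_top hmB (setLIntegral_atTime_le _ B)]
      refine Finset.sum_congr rfl fun j _ => ?_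
      exact integral_toReal ((p.atTime _).measurable_coe hB).aemeasurable
        (.of_forall fun y => (p.atTime_le_one _ y B).trans_lt ENNReal.one_lt_top)
    have h3 := ENNReal.toReal_mono
      (ENNReal.add_ne_top.2 ⟨ENNReal.mul_ne_top ENNReal.coe_ne_top hmB, hI⟩)
      (sum_setLIntegral_atTime_le hp hB t n)
    rw [ENNReal.toReal_mul, ENNReal.toReal_add (ENNReal.mul_ne_top ENNReal.coe_ne_top hmB) hI,
      ENNReal.toReal_mul, ENNReal.coe_toReal, ← h2] at h3
    rw [inv_mul_eq_div, le_div_iff₀ (by exact_mod_cast ht)]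
    nlinarith [mul_nonneg h1 t.coe_nonneg]
  calc _ ≤ _ := hcs
    _ ≤ _ := mul_le_mul_of_nonneg_left hbound hnonneg
    _ = _ := by ring

theorem sq_setIntegral_le_of_tendsto_approxForm (hp : p.IsSymmetric m) {B : Set X}
    (hB : MeasurableSet B) (hmB : m B ≠ ∞)
    (hI : ∫⁻ s in Set.Ioi (0 : ℝ), ∫⁻ x in B, p.atTime s.toNNReal x B ∂m ≠ ∞)
    {w : Lp ℝ 2 m} (hw : ∀ᵐ x ∂m, 0 ≤ w x) {c : ℝ}
    (hc : Tendsto (fun t : ℝ≥0 => p.approxForm t w w) (𝓝[>] 0) (𝓝 c)) :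
    (∫ x in B, w x ∂m) ^ 2 ≤ c *
      (∫⁻ s in Set.Ioi (0 : ℝ), ∫⁻ x in B, p.atTime s.toNNReal x B ∂m).toReal := by
  -- A representative that is measurable and nonnegative everywhere, as the Cauchy-Schwarz
  -- inequality requires.
  set v : X → ℝ := fun x => max ((Lp.aestronglyMeasurable w).mk w x) 0 with hv
  have hvm : Measurable v :=
    (Lp.aestronglyMeasurable w).stronglyMeasurable_mk.measurable.max measurable_const
  have hv0 : 0 ≤ v := fun x => le_max_right _ _
  have hwv : w =ᵐ[m] v := by
    filter_upwards [hw, (Lp.aestronglyMeasurable w).ae_eq_mk] with x h0 hx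
    exact hx.trans (max_eq_left (hx ▸ h0)).symm
  have hvL : MemLp v 2 m := (memLp_congr_ae hwv).1 (Lp.memLp w)
  rw [integral_congr_ae (ae_restrict_of_ae hwv)]
  have hlim : Tendsto (fun t : ℝ≥0 => p.approxForm t w w * (t * (m B).toReal +
      (∫⁻ s in Set.Ioi (0 : ℝ), ∫⁻ x in B, p.atTime s.toNNReal x B ∂m).toReal)) (𝓝[>] 0)
      (𝓝 (c * (((0 : ℝ≥0) : ℝ) * (m B).toReal +
        (∫⁻ s in Set.Ioi (0 : ℝ), ∫⁻ x in B, p.atTime s.toNNReal x B ∂m).toReal))) := by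
    refine hc.mul (Tendsto.add_const _ (Tendsto.mul_const _ ?_))
    exact (NNReal.continuous_coe.tendsto 0).mono_left nhdsWithin_le_nhds
  rw [NNReal.coe_zero, zero_mul, zero_add] at hlim
  refine ge_of_tendsto hlim ?_
  filter_upwards [self_mem_nhdsWithin] with t (ht : 0 < t)
  rw [approxForm_self_eq hp t hwv]
  have h1 := (tendsto_const_nhds (x := ∫ x in B, v x ∂m)).sub
    (tendsto_integral_atTime_mul hp hB hmB hI ht hvL hv0)
  rw [sub_zero] at h1
  exact le_of_tendsto (h1.pow 2) (.of_forall fun n =>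
    integral_indicator_sub_atTime_mul_sq_le hp hB hmB hI ht hvL hvm hv0 n)

theorem measurable_green {f : X → ℝ≥0∞} (hf : Measurable f) : Measurable (p.green f) := by
  unfold green
  refine Measurable.lintegral_prod_right' (f := fun z : X × ℝ =>
    ∫⁻ y, f y ∂(p.kernel (z.2.toNNReal, z.1))) ?_
  exact hf.lintegral_kernel.comp
    ((measurable_real_toNNReal.comp measurable_snd).prodMk measurable_fst)

theorem setLIntegral_green (f : X → ℝ≥0∞) (hf : Measurable f) (B : Set X) :
    ∫⁻ x in B, p.green f x ∂m =
      ∫⁻ s in Set.Ioi (0 : ℝ), ∫⁻ x in B, ∫⁻ y, f y ∂(p.atTime s.toNNReal x) ∂m := by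
  unfold green
  refine lintegral_lintegral_swap (Measurable.aemeasurable ?_)
  exact hf.lintegral_kernel.comp
    ((measurable_real_toNNReal.comp measurable_snd).prodMk measurable_fst)

end Transience

/-- A symmetric transition function is not transient if there are functions `w_k` with
`0 ≤ w_k ≤ 1`, `w_k → 1` and with energies tending to `0`. -/
theorem not_isTransient_of_tendsto {X : Type*} [MeasurableSpace X] {p : TransitionFunction X}
    {m : Measure X} [SigmaFinite m] (hm : m ≠ 0) (hp : p.IsSymmetric m) (w : ℕ → Lp ℝ 2 m)
    (c : ℕ → ℝ) (hw : ∀ k, ∀ᵐ x ∂m, 0 ≤ w k x ∧ w k x ≤ 1)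
    (hlim : ∀ᵐ x ∂m, Tendsto (fun k => w k x) atTop (𝓝 1))
    (hc : ∀ k, Tendsto (fun t : ℝ≥0 => p.approxForm t (w k) (w k)) (𝓝[>] 0) (𝓝 (c k)))
    (hc0 : Tendsto c atTop (𝓝 0)) : ¬ p.IsTransient m := by
  intro htrans
  have : NeZero m := ⟨hm⟩
  obtain ⟨A, hA, hmA, hA0⟩ : ∃ A, MeasurableSet A ∧ m A ≠ ∞ ∧ m A ≠ 0 := by
    by_contra! hcon
    refine hm (Measure.measure_univ_eq_zero.1 ?_)
    rw [← iUnion_spanningSets m, measure_iUnion_null_iff]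
    exact fun i => hcon _ (measurableSet_spanningSets m i) (measure_spanningSets_lt_top m i).ne
  set f : X → ℝ≥0∞ := A.indicator fun _ => 1 with hf
  have hfm : Measurable f := measurable_const.indicator hA
  have hG := htrans f hfm (by simpa [hf, lintegral_indicator hA] using hmA)
  have hGm : Measurable (p.green f) := measurable_green hfm
  -- The potential is bounded by `n` on `B n`, which makes `I(B n)` finite; these sets exhaust `A`
  -- up to a null set.
  set B : ℕ → Set X := fun n => A ∩ {x | p.green f x ≤ n} with hBdef
  have hB : ∀ n, MeasurableSet (B n) := fun n => hA.inter (hGm measurableSet_Iic)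
  have hmB : ∀ n, m (B n) ≠ ∞ := fun n =>
    ne_top_of_le_ne_top hmA (measure_mono Set.inter_subset_left)
  have hBzero : ∀ n, m (B n) = 0 := by
    intro n
    have hI : ∫⁻ s in Set.Ioi (0 : ℝ), ∫⁻ x in B n, p.atTime s.toNNReal x (B n) ∂m ≠ ∞ := by
      refine ne_top_of_le_ne_top
        (ENNReal.mul_ne_top (ENNReal.natCast_ne_top n) (hmB n)) ?_
      calc _ ≤ ∫⁻ s in Set.Ioi (0 : ℝ), ∫⁻ x in B n,
            ∫⁻ y, f y ∂(p.atTime s.toNNReal x) ∂m := by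
            gcongr with s x
            rw [hf, lintegral_indicator_const hA, one_mul]
            exact measure_mono Set.inter_subset_left
        _ = ∫⁻ x in B n, p.green f x ∂m := (setLIntegral_green f hfm _).symm
        _ ≤ ∫⁻ x in B n, n ∂m := setLIntegral_mono' (hB n) fun x hx => hx.2
        _ = n * m (B n) := by rw [setLIntegral_const]
    have hint : Tendsto (fun k => ∫ x in B n, w k x ∂m) atTop (𝓝 (∫ x in B n, (1 : ℝ) ∂m)) := by
      have hfin : IsFiniteMeasure (m.restrict (B n)) := ⟨by simpa using (hmB n).lt_top⟩
      refine tendsto_integral_of_dominated_convergence (fun _ => 1)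
        (fun k => (Lp.aestronglyMeasurable (w k)).restrict) (integrable_const 1) (fun k => ?_)
        (ae_restrict_of_ae hlim)
      filter_upwards [ae_restrict_of_ae (hw k)] with x hx
      rw [Real.norm_of_nonneg hx.1]
      exact hx.2
    have hle := le_of_tendsto_of_tendsto' (hint.pow 2) (hc0.mul_const _) fun k =>
      sq_setIntegral_le_of_tendsto_approxForm hp (hB n) (hmB n) hI
        ((hw k).mono fun x hx => hx.1) (hc k)
    rw [zero_mul, setIntegral_const, smul_eq_mul, mul_one] at hle
    have h0 := pow_eq_zero_iff two_ne_zero |>.1 (le_antisymm hle (sq_nonneg _))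
    exact (measureReal_eq_zero_iff (hmB n)).1 h0
  refine hA0 (measure_mono_null_ae (t := ⋃ n, B n) ?_ (measure_iUnion_null_iff.2 hBzero))
  filter_upwards [hG] with x hx hxA
  obtain ⟨n, hn⟩ := ENNReal.exists_nat_gt hx.ne
  exact Set.mem_iUnion.2 ⟨n, hxA, hn.le⟩

end TransitionFunction

/-! ### Finite product measures and tensor products of functions -/

section PiMeasure

variable {ι : Type*} [Fintype ι] {X : ι → Type*} [∀ i, MeasurableSpace (X i)]
  {m : ∀ i, Measure (X i)} [∀ i, SigmaFinite (m i)]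

theorem generateFrom_measurableSet_measure_lt_top {Y : Type*} [MeasurableSpace Y] (μ : Measure Y)
    [SigmaFinite μ] :
    MeasurableSpace.generateFrom {s : Set Y | MeasurableSet s ∧ μ s < ∞} = ‹_› := by
  refine le_antisymm (MeasurableSpace.generateFrom_le fun s hs => hs.1) fun s hs => ?_
  rw [← Set.inter_univ s, ← iUnion_spanningSets μ, Set.inter_iUnion]
  refine MeasurableSet.iUnion fun n => MeasurableSpace.measurableSet_generateFrom ⟨?_, ?_⟩
  · exact hs.inter (measurableSet_spanningSets μ n)
  · exact (measure_mono Set.inter_subset_right).trans_lt (measure_spanningSets_lt_top μ n)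

/-- Two measures on a finite product, the first one dominated by the product measure, are equal if
they agree on the boxes with sides of finite measure. -/
theorem MeasureTheory.Measure.ext_of_le_pi {ν₁ ν₂ : Measure (∀ i, X i)} (hle : ν₁ ≤ Measure.pi m)
    (h : ∀ s : ∀ i, Set (X i), (∀ i, MeasurableSet (s i) ∧ m i (s i) < ∞) →
      ν₁ (Set.univ.pi s) = ν₂ (Set.univ.pi s)) : ν₁ = ν₂ := by
  let C : ∀ i, Set (Set (X i)) := fun i => {s | MeasurableSet s ∧ m i s < ∞}
  have hspan : ∀ i, (m i).FiniteSpanningSetsIn (C i) := fun i =>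
    ⟨spanningSets (m i),
      fun n => ⟨measurableSet_spanningSets _ n, measure_spanningSets_lt_top _ n⟩,
      fun n => measure_spanningSets_lt_top _ n, iUnion_spanningSets _⟩
  refine ((Measure.FiniteSpanningSetsIn.pi hspan).ofLE hle).ext
    (generateFrom_eq_pi (fun i => generateFrom_measurableSet_measure_lt_top (m i))
      fun i => (hspan i).isCountablySpanning).symm (IsPiSystem.pi fun i => ?_) ?_
  · rintro s ⟨hs, hs'⟩ t ⟨ht, _⟩ _
    exact ⟨hs.inter ht, (measure_mono Set.inter_subset_left).trans_lt hs'⟩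
  · rintro _ ⟨s, hs, rfl⟩
    exact h s fun i => hs i (Set.mem_univ i)

theorem memLp_two_fintype_prod {u : ∀ i, X i → ℝ} (hu : ∀ i, MemLp (u i) 2 (m i)) :
    MemLp (fun x : ∀ i, X i => ∏ i, u i (x i)) 2 (Measure.pi m) := by
  rw [memLp_two_iff_integrable_sq]
  · simp_rw [← Finset.prod_pow]
    exact Integrable.fintype_prod_dep (f := fun i x => u i x ^ 2) fun i => (hu i).integrable_sq
  · exact Finset.aestronglyMeasurable_fun_prod _ fun i _ =>
      (hu i).aestronglyMeasurable.comp_quasiMeasurePreserving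
        (Measure.quasiMeasurePreserving_eval m i)

end PiMeasure

/-- The one-sided derivative at `0` of a finite product, with bounds on it. -/
theorem exists_tendsto_inv_mul_prod_sub_prod {ι : Type*} (s : Finset ι) {a e : ι → ℝ}
    {b : ι → ℝ≥0 → ℝ} {ε : ℝ} (ha : ∀ i, 0 ≤ a i) (he : ∀ i, 0 ≤ e i) (hea : ∀ i, e i ≤ ε * a i)
    (hb : ∀ i, Tendsto (fun t : ℝ≥0 => (t : ℝ)⁻¹ * (a i - b i t)) (𝓝[>] 0) (𝓝 (e i))) :
    ∃ c : ℝ, 0 ≤ c ∧ c ≤ ε * s.card * ∏ i ∈ s, a i ∧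
      Tendsto (fun t : ℝ≥0 => (t : ℝ)⁻¹ * (∏ i ∈ s, a i - ∏ i ∈ s, b i t)) (𝓝[>] 0) (𝓝 c) := by
  classical
  induction s using Finset.induction_on with
  | empty => exact ⟨0, le_rfl, by simp, by simp⟩
  | insert i s hi ih =>
    obtain ⟨c, hc0, hc1, hc⟩ := ih
    have hprod : 0 ≤ ∏ j ∈ s, a j := Finset.prod_nonneg fun j _ => ha j
    -- A finite difference quotient forces `b i t → a i`, the continuity needed for the product
    -- rule.
    have hbi : Tendsto (b i) (𝓝[>] 0) (𝓝 (a i)) := by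
      have h0 : Tendsto (fun t : ℝ≥0 => (t : ℝ)) (𝓝[>] 0) (𝓝 0) :=
        (NNReal.continuous_coe.tendsto 0).mono_left nhdsWithin_le_nhds
      have h1 := (tendsto_const_nhds (x := a i)).sub (h0.mul (hb i))
      rw [zero_mul, sub_zero] at h1
      refine h1.congr' ?_
      filter_upwards [self_mem_nhdsWithin] with t (ht : 0 < t)
      rw [mul_inv_cancel_left₀ (by exact_mod_cast ht.ne')]
      ring
    refine ⟨e i * ∏ j ∈ s, a j + a i * c, ?_, ?_, ?_⟩
    · exact add_nonneg (mul_nonneg (he i) hprod) (mul_nonneg (ha i) hc0)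
    · rw [Finset.prod_insert hi, Finset.card_insert_of_notMem hi]
      push_cast
      have h1 := mul_le_mul_of_nonneg_right (hea i) hprod
      have h2 := mul_le_mul_of_nonneg_left hc1 (ha i)
      linarith
    · refine (((hb i).mul_const (∏ j ∈ s, a j)).add (hbi.mul hc)).congr fun t => ?_
      rw [Finset.prod_insert hi, Finset.prod_insert hi]
      ring

/-! ### Symmetry and approximating forms of the product process -/

namespace TransitionFunction

theorem IsAssociated.isSymmetric {Y : Type*} [MeasurableSpace Y] {p : TransitionFunction Y}
    {μ : Measure Y} {𝓔 : DirichletForm μ} (h : p.IsAssociated 𝓔) : p.IsSymmetric μ := h.1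

variable {ι : Type*} [Fintype ι] {X : ι → Type*} [∀ i, MeasurableSpace (X i)]
  {m : ∀ i, Measure (X i)} [∀ i, SigmaFinite (m i)] {p : ∀ i, TransitionFunction (X i)}

theorem product_atTime (t : ℝ≥0) (x : ∀ i, X i) :
    (product p).atTime t x = Measure.pi fun i => (p i).atTime t (x i) := rfl

theorem setLIntegral_product_atTime_pi (t : ℝ≥0) {S T : ∀ i, Set (X i)}
    (hS : ∀ i, MeasurableSet (S i) ∧ m i (S i) < ∞)
    (hT : ∀ i, MeasurableSet (T i)) :
    ∫⁻ x in Set.univ.pi S, (product p).atTime t x (Set.univ.pi T) ∂(Measure.pi m) =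
      ∏ i, ∫⁻ x in S i, (p i).atTime t x (T i) ∂(m i) := by
  have hfin : ∀ i, IsFiniteMeasure ((m i).restrict (S i)) := fun i => ⟨by simpa using (hS i).2⟩
  simp_rw [product_atTime, Measure.pi_pi]
  rw [Measure.restrict_pi_pi]
  exact lintegral_prod_le_one _ (fun i x => (p i).atTime t x (T i))
    (fun i => ((p i).atTime t).measurable_coe (hT i)) fun i x => (p i).atTime_le_one t x _

/-- On boxes both sides factor and symmetry holds coordinatewise. The passage to general sets is
made in one variable at a time. -/
theorem IsSymmetric.product (hp : ∀ i, (p i).IsSymmetric (m i)) :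
    (product p).IsSymmetric (Measure.pi m) := by
  intro t A B hA hB
  set κ := (TransitionFunction.product p).atTime t
  -- With `A` fixed, both sides are measures in `B`; the first has density at most `1`, so agreement
  -- on boxes of finite measure suffices. Used once with `A` a box, then with an arbitrary set in
  -- its place.
  have step : ∀ A, MeasurableSet A → (∀ s : ∀ i, Set (X i),
      (∀ i, MeasurableSet (s i) ∧ m i (s i) < ∞) →
      ∫⁻ x in Set.univ.pi s, κ x A ∂(Measure.pi m) =
        ∫⁻ x in A, κ x (Set.univ.pi s) ∂(Measure.pi m)) → ∀ B, MeasurableSet B →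
      ∫⁻ x in B, κ x A ∂(Measure.pi m) = ∫⁻ x in A, κ x B ∂(Measure.pi m) := by
    intro A hA h B hB
    have heq : (Measure.pi m).withDensity (fun x => κ x A) =
        ((Measure.pi m).restrict A).bind κ := by
      refine Measure.ext_of_le_pi (m := m) ?_ fun s hs => ?_
      · refine (withDensity_mono (g := 1) (.of_forall fun x => atTime_le_one _ t x A)).trans ?_
        rw [withDensity_one]
      · have hsm := MeasurableSet.univ_pi fun i => (hs i).1
        rw [withDensity_apply _ hsm, Measure.bind_apply hsm κ.measurable.aemeasurable]
        exact h s hs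
    rw [← withDensity_apply _ hB, heq, Measure.bind_apply hB κ.measurable.aemeasurable]
  refine step B hB (fun T hT => ?_) A hA
  refine (step _ (MeasurableSet.univ_pi fun i => (hT i).1) (fun S hS => ?_) B hB).symm
  rw [setLIntegral_product_atTime_pi t hS fun i => (hT i).1,
    setLIntegral_product_atTime_pi t hT fun i => (hS i).1]
  exact Finset.prod_congr rfl fun i _ => hp i t _ _ (hS i).1 (hT i).1

theorem approxForm_self_eq_sub {Y : Type*} [MeasurableSpace Y] {q : TransitionFunction Y}
    {μ : Measure Y} [SFinite μ] (hq : q.IsSymmetric μ) (t : ℝ≥0) {U : Lp ℝ 2 μ} {v : Y → ℝ}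
    (h : U =ᵐ[μ] v) : q.approxForm t U U =
      (t : ℝ)⁻¹ * (∫ x, v x * v x ∂μ - ∫ x, v x * ∫ y, v y ∂(q.atTime t x) ∂μ) := by
  have hv : MemLp v 2 μ := (memLp_congr_ae h).1 (Lp.memLp U)
  rw [approxForm_self_eq hq t h, (hq.isReversible t).integral_sub_mul (q.atTime_univ_le_one t) hv hv]

theorem approxForm_product (hp : ∀ i, (p i).IsSymmetric (m i)) (t : ℝ≥0)
    {U : Lp ℝ 2 (Measure.pi m)} {u : ∀ i, X i → ℝ}
    (h : U =ᵐ[Measure.pi m] fun x => ∏ i, u i (x i)) :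
    (product p).approxForm t U U = (t : ℝ)⁻¹ * (∏ i, ∫ x, u i x * u i x ∂(m i) -
      ∏ i, ∫ x, u i x * ∫ y, u i y ∂((p i).atTime t x) ∂(m i)) := by
  rw [approxForm_self_eq_sub (IsSymmetric.product hp) t h]
  simp_rw [product_atTime, integral_fintype_prod_eq_prod, ← Finset.prod_mul_distrib]
  rw [integral_fintype_prod_eq_prod (fun i x => u i x * u i x),
    integral_fintype_prod_eq_prod (fun i x => u i x * ∫ y, u i y ∂((p i).atTime t x))]

end TransitionFunction

/-! ### Selected functions and the main theorem -/

namespace DirichletForm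

/-- Treats finite and infinite index alike: a finite infimum in `ℕ∞` is attained, and at `⊤` the
constant `1` has energy zero. -/
theorem exists_ae_eq_selected {X : Type*} [MeasurableSpace X] {μ : Measure X}
    (𝓔 : DirichletForm μ) (u : ℕ → 𝓔.domain) (k : ℕ)
    (h_top : 𝓔.index u k = ⊤ → ∃ e : 𝓔.domain,
      ((e : Lp ℝ 2 μ) : X → ℝ) =ᵐ[μ] (fun _ => 1) ∧ 𝓔.form e e = 0) :
    ∃ v : 𝓔.domain, ((v : Lp ℝ 2 μ) : X → ℝ) =ᵐ[μ] 𝓔.selected u k ∧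
      𝓔.form v v ≤ 1 / (k : ℝ) * ∫ x, 𝓔.selected u k x * 𝓔.selected u k x ∂μ := by
  by_cases h : 𝓔.index u k = ⊤
  · obtain ⟨e, he, he0⟩ := h_top h
    refine ⟨e, ?_, ?_⟩
    · filter_upwards [he] with x hx
      simpa [selected, h] using hx
    · rw [he0]
      exact mul_nonneg (by positivity) (integral_nonneg fun x => mul_self_nonneg _)
  · have hne : {a : ℕ∞ | ∃ n : ℕ, 1 ≤ n ∧ a = n ∧ 𝓔.form (u n) (u n) ≤
        1 / (k : ℝ) * ∫ x, (u n : Lp ℝ 2 μ) x * (u n : Lp ℝ 2 μ) x ∂μ}.Nonempty := by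
      by_contra hcon
      rw [Set.not_nonempty_iff_eq_empty] at hcon
      exact h (by rw [index, hcon, sInf_empty])
    obtain ⟨n, -, hn, hle⟩ := csInf_mem hne
    have hidx : 𝓔.index u k = n := hn
    have hsel : 𝓔.selected u k = (u n : Lp ℝ 2 μ) := by
      ext x
      simp [selected, hidx]
    rw [hsel]
    exact ⟨u n, ae_eq_rfl, hle⟩

end DirichletForm

theorem proposition3p1 {N : ℕ} (X : Fin N → Type*) [∀ i, MetricSpace (X i)]
    [∀ i, LocallyCompactSpace (X i)] [∀ i, SecondCountableTopology (X i)]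
    [∀ i, Nonempty (X i)] [∀ i, MeasurableSpace (X i)] [∀ i, BorelSpace (X i)]
    (m : ∀ i, Measure (X i)) [∀ i, IsFiniteMeasureOnCompacts (m i)]
    [∀ i, (m i).IsOpenPosMeasure]
    (𝓔 : ∀ i, DirichletForm (m i)) (hreg : ∀ i, (𝓔 i).IsRegular)
    (p : ∀ i, TransitionFunction (X i)) (hp : ∀ i, (p i).IsAssociated (𝓔 i))
    (u : ∀ i, ℕ → (𝓔 i).domain)
    (h_top : ∀ i, (∃ k : ℕ, 1 ≤ k ∧ (𝓔 i).index (u i) k = ⊤) →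
      ∃ e : (𝓔 i).domain, ((e : Lp ℝ 2 (m i)) : X i → ℝ) =ᵐ[m i] (fun _ => 1) ∧
        (𝓔 i).form e e = 0)
    (h_unit : ∀ i, ∀ k : ℕ, 1 ≤ k →
      ∀ᵐ x ∂(m i), 0 ≤ (𝓔 i).selected (u i) k x ∧ (𝓔 i).selected (u i) k x ≤ 1)
    (h_lim : ∀ i, ∀ᵐ x ∂(m i),
      Tendsto (fun k : ℕ => (𝓔 i).selected (u i) k x) atTop (𝓝 1))
    (h_prod : Tendsto (fun k : ℕ => 1 / (k : ℝ) *
      ∏ i, ∫ x, (𝓔 i).selected (u i) k x * (𝓔 i).selected (u i) k x ∂(m i)) atTop (𝓝 0)) :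
    ¬ (TransitionFunction.product p).IsTransient (Measure.pi m) ∧
    ∀ 𝓕 : DirichletForm (Measure.pi m),
      (TransitionFunction.product p).IsAssociated 𝓕 → ¬ 𝓕.IsTransient := by
  have hm0 : Measure.pi m ≠ 0 := by
    rw [← Measure.measure_univ_ne_zero, Measure.pi_univ]
    exact Finset.prod_ne_zero_iff.2 fun i _ => isOpen_univ.measure_ne_zero (m i) Set.univ_nonempty
  -- The index is shifted to `k + 1` because the hypotheses concern `k ≥ 1` only.
  choose v hv hvE using fun i (k : ℕ) => (𝓔 i).exists_ae_eq_selected (u i) (k + 1) fun h =>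
    h_top i ⟨k + 1, Nat.le_add_left 1 k, h⟩
  set s : ∀ i, ℕ → X i → ℝ := fun i k => (𝓔 i).selected (u i) (k + 1) with hs
  have hsL : ∀ i k, MemLp (s i k) 2 (m i) := fun i k =>
    (memLp_congr_ae (hv i k)).1 (Lp.memLp _)
  have hwL : ∀ k, MemLp (fun x : ∀ i, X i => ∏ i, s i k (x i)) 2 (Measure.pi m) := fun k =>
    memLp_two_fintype_prod fun i => hsL i k
  set w : ℕ → Lp ℝ 2 (Measure.pi m) := fun k => (hwL k).toLp _ with hw
  have hwae : ∀ k, w k =ᵐ[Measure.pi m] fun x => ∏ i, s i k (x i) := fun k => (hwL k).coeFn_toLp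
  have hsymm : ∀ i, (p i).IsSymmetric (m i) := fun i => (hp i).isSymmetric
  have hc : ∀ k, ∃ c : ℝ, 0 ≤ c ∧ c ≤ N * (1 / ((k + 1 : ℕ) : ℝ) *
      ∏ i, ∫ x, s i k x * s i k x ∂(m i)) ∧ Tendsto (fun t : ℝ≥0 =>
        (TransitionFunction.product p).approxForm t (w k) (w k)) (𝓝[>] 0) (𝓝 c) := by
    intro k
    have hb : ∀ i, Tendsto (fun t : ℝ≥0 => (t : ℝ)⁻¹ * (∫ x, s i k x * s i k x ∂(m i) -
        ∫ x, s i k x * ∫ y, s i k y ∂((p i).atTime t x) ∂(m i))) (𝓝[>] 0)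
        (𝓝 ((𝓔 i).form (v i k) (v i k))) := fun i =>
      ((hp i).2.2 (v i k) (v i k)).congr fun t =>
        TransitionFunction.approxForm_self_eq_sub (hsymm i) t (hv i k)
    obtain ⟨c, h0, h1, h2⟩ := exists_tendsto_inv_mul_prod_sub_prod Finset.univ
      (fun i => integral_nonneg fun x => mul_self_nonneg (s i k x))
      (fun i => (𝓔 i).nonneg (v i k)) (fun i => hvE i k) hb
    refine ⟨c, h0, h1.trans (le_of_eq ?_), h2.congr fun t =>
      (TransitionFunction.approxForm_product hsymm t (hwae k)).symm⟩
    rw [Finset.card_univ, Fintype.card_fin]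
    ring
  choose c hc0 hc1 hc using hc
  have hclim : Tendsto c atTop (𝓝 0) := by
    refine squeeze_zero hc0 hc1 ?_
    simpa using ((tendsto_add_atTop_iff_nat 1).2 h_prod).const_mul (N : ℝ)
  have hwunit : ∀ k, ∀ᵐ x ∂(Measure.pi m), 0 ≤ w k x ∧ w k x ≤ 1 := by
    intro k
    have h1 : ∀ᵐ x ∂(Measure.pi m), ∀ i, 0 ≤ s i k (x i) ∧ s i k (x i) ≤ 1 :=
      ae_all_iff.2 fun i => (Measure.quasiMeasurePreserving_eval m i).ae
        (h_unit i (k + 1) (Nat.le_add_left 1 k))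
    filter_upwards [h1, hwae k] with x hx hxw
    rw [hxw]
    exact ⟨Finset.prod_nonneg fun i _ => (hx i).1,
      Finset.prod_le_one (fun i _ => (hx i).1) fun i _ => (hx i).2⟩
  have hwlim : ∀ᵐ x ∂(Measure.pi m), Tendsto (fun k => w k x) atTop (𝓝 1) := by
    have h1 : ∀ᵐ x ∂(Measure.pi m), ∀ i, Tendsto (fun k => s i k (x i)) atTop (𝓝 1) :=
      ae_all_iff.2 fun i => (Measure.quasiMeasurePreserving_eval m i).ae
        ((h_lim i).mono fun x hx => (tendsto_add_atTop_iff_nat 1).2 hx)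
    filter_upwards [h1, ae_all_iff.2 hwae] with x hx hxw
    simp_rw [hxw]
    simpa using tendsto_finsetProd Finset.univ fun i _ => hx i
  refine ⟨TransitionFunction.not_isTransient_of_tendsto hm0
    (TransitionFunction.IsSymmetric.product hsymm) w c hwunit hwlim hc hclim, ?_⟩
  -- The transient process `q` associated with `𝓕` need not be the product process. But `𝓕`
  -- determines the energies: each `w k` lies in its domain with energy `c k`, so the criterion
  -- applies to `q` with the same data.
  rintro 𝓕 h𝓕 ⟨q, hq, hqt⟩
  refine TransitionFunction.not_isTransient_of_tendsto hm0 hq.isSymmetric w c hwunit hwlim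
    (fun k => ?_) hclim hqt
  have hmem : w k ∈ 𝓕.domain := (h𝓕.2.1 _).2 ⟨c k, hc k⟩
  have hform : 𝓕.form ⟨w k, hmem⟩ ⟨w k, hmem⟩ = c k :=
    tendsto_nhds_unique (h𝓕.2.2 ⟨w k, hmem⟩ ⟨w k, hmem⟩) (hc k)
  rw [← hform]
  exact hq.2.2 ⟨w k, hmem⟩ ⟨w k, hmem⟩
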